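/- Let $0<q<1$ and $\alpha>-1$. Write $(a;q)_n=\prod_{k=0}^{n-1}(1-aq^k)$, $(a;q)_\infty=\prod_{k\ge 0}(1-aq^k)$, $[n]_q=\frac{1-q^n}{1-q}$, $[n]_q!=\prod_{k=1}^n[k]_q$. Let $$J^{(2)}_\alpha(z;q)=\frac{(q^{\alpha+1};q)_\infty}{(q;q)_\infty}\sum_{n=0}^\infty(-1)^n\frac{q^{n(n+\alpha)}(z/2)^{2n+\alpha}}{(q;q)_n(q^{\alpha+1};q)_n},\qquad \mathcal J^{(2)}_\alpha(z;q)=\sum_{n=0}^\infty(-1)^n\frac{q^{n(n+\alpha)}(z/2)^{2n}}{(q;q)_n(q^{\alpha+1};q)_n}$$ be Jackson's second $q$-Bessel function and its modified (entire) form, let $$E_q(z)=\sum_{n=0}^\infty\frac{q^{n(n-1)/2}}{(q;q)_n}(z(1-q))^n,\qquad Cos_q(z)=\frac{E_q(iz)+E_q(-iz)}{2},\qquad Sin_q(z)=\frac{E_q(iz)-E_q(-iz)}{2i},$$ and let the generalized $q$-Bernoulli polynomials $B^{(2)}_{n,\alpha}(z;q)$ be defined by the Taylor expansion at $t=0$ $$\frac{E_q(zt)\,E_q(-t/2)}{\mathcal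 J^{(2)}_\alpha(it(1-q);q^2)}=\sum_{n=0}^\infty B^{(2)}_{n,\alpha}(z;q)\frac{t^n}{[n]_q!}.$$ **Theorem 3.1.** The function $J^{(2)}_\alpha(\cdot;q^2)$ has a smallest positive zero $j^{(2)}_{1,\alpha}$, and $D:=\frac{d}{dw}\mathcal J^{(2)}_\alpha(w;q^2)\big|_{w=j^{(2)}_{1,\alpha}}\neq 0$. Put $\zeta:=\dfrac{j^{(2)}_{1,\alpha}}{2(1-q)}$. Then for every $z\in\mathbb C$ and every $r$ with $0<r\le 2\zeta$, as $n\to\infty$, $$B^{(2)}_{2n,\alpha}(z;q)=\frac{2}{1-q}\,\frac{(-1)^{n+1}[2n]_q!\,\bigl(Cos_q(2\zeta z)Cos_q(\zeta)+Sin_q(2\zeta z)Sin_q(\zeta)\bigr)}{(2\zeta)^{2n+1}D}+[2n]_q!\;o(r^{-2n}),$$ $$B^{(2)}_{2n+1,\alpha}(z;q)=\frac{2}{1-q}\,\frac{(-1)^{n+1}[2n+1]_q!\,\bigl(Sin_q(2\zeta z)Cos_q(\zeta)-Cos_q(2\zeta z)Sin_q(\zeta)\bigr)}{(2\zeta)^{2n+2}D}+[2n+1]_q!\;o(r^{-2n}).$$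 -/

import Mathlib

namespace QBernoulli

noncomputable section

/-- The finite `q`-shifted factorial `(a;q)_n = ∏_{k<n} (1 - a q^k)`. -/
def qPoch (a q : ℝ) (n : ℕ) : ℝ := ∏ k ∈ Finset.range n, (1 - a * q ^ k)

/-- The infinite `q`-shifted factorial `(a;q)_∞ = ∏_{k≥0} (1 - a q^k)`. -/
def qPochInf (a q : ℝ) : ℝ := ∏' k : ℕ, (1 - a * q ^ k)

/-- The `q`-number `[n]_q = (1 - q^n) / (1 - q)`. -/
def qNat (q : ℝ) (n : ℕ) : ℝ := (1 - q ^ n) / (1 - q)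

/-- The `q`-factorial `[n]_q! = [1]_q [2]_q ⋯ [n]_q`. -/
def qFact (q : ℝ) (n : ℕ) : ℝ := ∏ k ∈ Finset.range n, qNat q (k + 1)

/-- Jackson's second `q`-Bessel function
`J_α^{(2)}(z;q) = (q^{α+1};q)_∞ / (q;q)_∞ *
  ∑_n (-1)^n q^{n(α+n)} (z/2)^{2n+α} / ((q;q)_n (q^{α+1};q)_n)`
(principal branch of the power). -/
def jacksonBessel2 (α q : ℝ) (z : ℂ) : ℂ :=
  ((qPochInf (q ^ (α + 1)) q / qPochInf q q : ℝ) : ℂ) *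
    ∑' n : ℕ, (-1) ^ n * ((q ^ ((n : ℝ) * (α + n)) : ℝ) : ℂ) * (z / 2) ^ (2 * (n : ℂ) + (α : ℂ)) /
      ((qPoch q q n * qPoch (q ^ (α + 1)) q n : ℝ) : ℂ)

/-- The modified Jackson `q`-Bessel function `𝒥_α^{(2)}(z;q)`, as an entire function of `z`: it is
`(q;q)_∞ / (q^{α+1};q)_∞ * (z/2)^{-α} * J_α^{(2)}(z;q)` with the singularity at `0` removed
(see `modBessel2_eq`). -/
def modBessel2 (α q : ℝ) (z : ℂ) : ℂ :=
  ∑' n : ℕ, (-1) ^ n * ((q ^ ((n : ℝ) * (α + n)) : ℝ) : ℂ) * (z / 2) ^ (2 * n) /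
      ((qPoch q q n * qPoch (q ^ (α + 1)) q n : ℝ) : ℂ)

theorem qPochInf_ne_zero {a q : ℝ} (ha0 : 0 < a) (ha1 : a < 1) (hq0 : 0 < q) (hq1 : q < 1) :
    qPochInf a q ≠ 0 := by
  have h : ∀ k : ℕ, 1 + -(a * q ^ k) ≠ 0 := by
    intro k
    have h1 : q ^ k ≤ 1 := pow_le_one₀ hq0.le hq1.le
    have h2 : a * q ^ k ≤ a * 1 := mul_le_mul_of_nonneg_left h1 ha0.le
    linarith
  have hs : Summable fun k : ℕ => ‖-(a * q ^ k)‖ := by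
    have := (summable_geometric_of_lt_one hq0.le hq1).mul_left a
    refine this.congr fun k => ?_
    rw [norm_neg, Real.norm_of_nonneg (by positivity)]
  have := tprod_one_add_ne_zero_of_summable h hs
  simpa [qPochInf, sub_eq_add_neg] using this

/-- For `z ≠ 0` the modified function is the normalized Jackson `q`-Bessel function. -/
theorem modBessel2_eq {α q : ℝ} (hα : -1 < α) (hq0 : 0 < q) (hq1 : q < 1) {z : ℂ} (hz : z ≠ 0) :
    modBessel2 α q z = ((qPochInf q q / qPochInf (q ^ (α + 1)) q : ℝ) : ℂ) *
      (z / 2) ^ (-(α : ℂ)) * jacksonBessel2 α q z := by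
  have hz2 : z / 2 ≠ 0 := by simpa using hz
  have h1 : qPochInf q q ≠ 0 := qPochInf_ne_zero hq0 hq1 hq0 hq1
  have h2 : qPochInf (q ^ (α + 1)) q ≠ 0 :=
    qPochInf_ne_zero (Real.rpow_pos_of_pos hq0 _)
      (Real.rpow_lt_one hq0.le hq1 (by linarith)) hq0 hq1
  have h3 : ((qPochInf q q / qPochInf (q ^ (α + 1)) q : ℝ) : ℂ) *
      ((qPochInf (q ^ (α + 1)) q / qPochInf q q : ℝ) : ℂ) = 1 := by
    rw [← Complex.ofReal_mul, div_mul_div_comm, mul_comm, div_self (mul_ne_zero h2 h1),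
      Complex.ofReal_one]
  rw [jacksonBessel2, mul_mul_mul_comm, h3, one_mul, ← tsum_mul_left, modBessel2]
  refine tsum_congr fun n => ?_
  have h4 : (z / 2) ^ (2 * n) = (z / 2) ^ (-(α : ℂ)) * (z / 2) ^ (2 * (n : ℂ) + (α : ℂ)) := by
    rw [← Complex.cpow_add _ _ hz2, ← Complex.cpow_natCast]
    congr 1
    push_cast
    ring
  rw [h4]
  ring

/-- `j_{1,α}^{(2)}`: the smallest positive zero of `J_α^{(2)}(·;q²)`. -/
def firstZero (α q : ℝ) : ℝ := sInf {x : ℝ | 0 < x ∧ jacksonBessel2 α (q ^ 2) (x : ℂ) = 0}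

/-- `ζ_{α,1} = j_{1,α}^{(2)} / (2 (1 - q))`. -/
def zeta1 (α q : ℝ) : ℝ := firstZero α q / (2 * (1 - q))

/-- Jackson's `q`-exponential `E_q(z) = ∑_n q^{n(n-1)/2} (z(1-q))^n / (q;q)_n`. -/
def bigE (q : ℝ) (z : ℂ) : ℂ :=
  ∑' n : ℕ, ((q ^ (n * (n - 1) / 2) : ℝ) : ℂ) * (z * (1 - (q : ℂ))) ^ n / ((qPoch q q n : ℝ) : ℂ)

/-- `Cos_q`, the even part of `z ↦ E_q(iz)`. -/
def bigCos (q : ℝ) (z : ℂ) : ℂ := (bigE q (Complex.I * z) + bigE q (-(Complex.I * z))) / 2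

/-- `Sin_q`: `i Sin_q` is the odd part of `z ↦ E_q(iz)`. -/
def bigSin (q : ℝ) (z : ℂ) : ℂ :=
  (bigE q (Complex.I * z) - bigE q (-(Complex.I * z))) / (2 * Complex.I)

theorem bigE_I_mul (q : ℝ) (z : ℂ) :
    bigE q (Complex.I * z) = bigCos q z + Complex.I * bigSin q z := by
  have := Complex.I_ne_zero
  unfold bigCos bigSin
  field_simp
  ring

/-- `g_α^{(2)}(t;q) = 𝒥_α^{(2)}(t(1-q);q²)`. -/
def gFun (α q : ℝ) (t : ℂ) : ℂ := modBessel2 α (q ^ 2) (t * (1 - (q : ℂ)))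

/-- The generating function `E_q(zt) E_q(-t/2) / g_α^{(2)}(it;q)` of the polynomials. -/
def genFun (α q : ℝ) (z t : ℂ) : ℂ :=
  bigE q (z * t) * bigE q (-t / 2) / gFun α q (Complex.I * t)

/-- The generalized `q`-Bernoulli polynomial `B_{n,α}^{(2)}(z;q)`: the coefficient of
`t^n / [n]_q!` in the Taylor expansion of the generating function at `t = 0`. -/
def qBernoulli2 (α q : ℝ) (n : ℕ) (z : ℂ) : ℂ :=
  ((qFact q n : ℝ) : ℂ) * (iteratedDeriv n (genFun α q z) 0 / (n.factorial : ℂ))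

/-- `d/dw 𝒥_α^{(2)}(w;q²)` at `w = j_{1,α}^{(2)}`. -/
def modBesselDeriv (α q : ℝ) : ℂ := deriv (modBessel2 α (q ^ 2)) (firstZero α q : ℂ)

end

end QBernoulli

namespace QBernoulli

open Filter Topology

/-! ### Entire functions given by real power series -/

/-! In the variable `x = (w / 2) ^ 2` the modified Bessel function is an entire series `φ_b`, with
base `p = q ^ 2` and `b = p ^ (α + 1)`. Raising the order by one replaces `b` by `b * p`, and `φ_b =
φ_{bp} - λ x φ_{bpp}` with `λ > 0` (`besselSeries_contiguous`). Along `b * p ^ k` the series tend to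
`1`, so sign conditions valid for large `k` descend to `k = 0` (`forall_of_eventually_of_step`). In
this way all zeros are shown to be positive reals, and a Wronskian inequality makes them simple and
forces one to exist. The least zero `y` is therefore simple and strictly smallest in modulus
(`exists_isLeast_besselSeries_zero`).

Hence in some disc of radius larger than `2ζ` the generating function has at most the two simple
poles `±2iζ` (`exists_genFun_eq`). Removing the polar parts leaves a function holomorphic on that
disc. Its Taylor series converges at `2iζ`, which gives the error `o((2ζ)^(-n))`, while the polar
parts give the main term (`exists_taylorCoeff_eq_of_two_poles`). The values of `E_q` at the poles
combine into `Cos_q` and `Sin_q` by the parity of the index. -/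

theorem differentiable_tsum_mul_pow {a : ℕ → ℝ} (h : ∀ R : ℝ, 0 < R → Summable fun n => |a n| * R ^ n) :
    Differentiable ℂ fun x : ℂ => ∑' n, (a n : ℂ) * x ^ n := by
  intro x
  have hR : 0 < ‖x‖ + 1 := by positivity
  have := Complex.differentiableOn_tsum_of_summable_norm (F := fun n (x : ℂ) => (a n : ℂ) * x ^ n)
    (U := Metric.ball 0 (‖x‖ + 1)) (h _ hR) (fun n => by fun_prop) Metric.isOpen_ball
    (fun n w hw => by
      rw [norm_mul, norm_pow, Complex.norm_real, Real.norm_eq_abs]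
      gcongr
      exact (mem_ball_zero_iff.1 hw).le)
  exact this.differentiableAt (Metric.isOpen_ball.mem_nhds (by simp))

theorem summable_mul_pow {a : ℕ → ℝ} (h : ∀ R : ℝ, 0 < R → Summable fun n => |a n| * R ^ n) (x : ℂ) :
    Summable fun n => (a n : ℂ) * x ^ n := by
  refine Summable.of_norm_bounded (h (‖x‖ + 1) (by positivity)) fun n => ?_
  rw [norm_mul, norm_pow, Complex.norm_real, Real.norm_eq_abs]
  gcongr
  simp

theorem summable_abs_mul_pow_of_ratio {a : ℕ → ℝ} (ha : ∀ n, a n ≠ 0)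
    (h : Tendsto (fun n => |a (n + 1)| / |a n|) atTop (𝓝 0)) (R : ℝ) (hR : 0 < R) :
    Summable fun n => |a n| * R ^ n := by
  refine summable_of_ratio_test_tendsto_lt_one zero_lt_one
    (Eventually.of_forall fun n => mul_ne_zero (abs_ne_zero.2 (ha n)) (by positivity)) ?_
  have := h.mul_const R
  rw [zero_mul] at this
  refine this.congr fun n => ?_
  have := abs_ne_zero.2 (ha n)
  rw [norm_mul, norm_mul, norm_pow, norm_pow, Real.norm_of_nonneg (abs_nonneg _),
    Real.norm_of_nonneg (abs_nonneg _), Real.norm_of_nonneg hR.le, pow_succ]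
  field_simp

/-! ### `q`-shifted factorials -/

theorem qPoch_zero (a p : ℝ) : qPoch a p 0 = 1 := by simp [qPoch]

theorem qPoch_succ (a p : ℝ) (n : ℕ) : qPoch a p (n + 1) = qPoch a p n * (1 - a * p ^ n) :=
  Finset.prod_range_succ _ _

theorem one_sub_mul_pow_pos {a p : ℝ} (ha0 : 0 ≤ a) (ha1 : a < 1) (hp0 : 0 ≤ p) (hp1 : p ≤ 1) (n : ℕ) :
    0 < 1 - a * p ^ n := by
  have := mul_le_mul_of_nonneg_left (pow_le_one₀ hp0 hp1 (n := n)) ha0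
  linarith

theorem qPoch_pos {a p : ℝ} (ha0 : 0 ≤ a) (ha1 : a < 1) (hp0 : 0 ≤ p) (hp1 : p ≤ 1) (n : ℕ) :
    0 < qPoch a p n :=
  Finset.prod_pos fun k _ => one_sub_mul_pow_pos ha0 ha1 hp0 hp1 k

theorem qPoch_mul_left (a p : ℝ) (n : ℕ) :
    (1 - a) * qPoch (a * p) p n = qPoch a p n * (1 - a * p ^ n) := by
  rw [← qPoch_succ, qPoch, qPoch, Finset.prod_range_succ', pow_zero, mul_one, mul_comm]
  congr 1
  exact Finset.prod_congr rfl fun k _ => by ring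

theorem qPoch_anti {a b p : ℝ} (hab : a ≤ b) (hb1 : b < 1) (hb0 : 0 ≤ b) (hp0 : 0 ≤ p) (hp1 : p ≤ 1)
    (n : ℕ) : qPoch b p n ≤ qPoch a p n :=
  Finset.prod_le_prod (fun k _ => (one_sub_mul_pow_pos hb0 hb1 hp0 hp1 k).le) fun k _ => by gcongr

/-! ### The power series of the modified Bessel function -/

/-- The coefficients of the modified Jackson `q`-Bessel function as a power series in `(w / 2) ^ 2`,
with `b = p ^ (α + 1)`. -/
noncomputable def besselCoeff (p b : ℝ) (n : ℕ) : ℝ :=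
  (-1) ^ n * p ^ (n * (n - 1)) * b ^ n / (qPoch p p n * qPoch b p n)

/-- The modified Jackson `q`-Bessel function in the variable `(w / 2) ^ 2`, with `b = p ^ (α + 1)`. -/
noncomputable def besselSeries (p b : ℝ) (x : ℂ) : ℂ := ∑' n, (besselCoeff p b n : ℂ) * x ^ n

section

variable {p b : ℝ} (hp0 : 0 < p) (hp1 : p < 1) (hb0 : 0 < b) (hb1 : b < 1)

include hp0 hp1 hb0 hb1

theorem besselCoeff_ne_zero (n : ℕ) : besselCoeff p b n ≠ 0 := by
  have h1 := qPoch_pos hp0.le hp1 hp0.le hp1.le n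
  have h2 := qPoch_pos hb0.le hb1 hp0.le hp1.le n
  unfold besselCoeff
  positivity

omit hp0 hp1 hb0 hb1 in
theorem besselCoeff_zero : besselCoeff p b 0 = 1 := by simp [besselCoeff, qPoch_zero]

theorem besselCoeff_succ (n : ℕ) : besselCoeff p b (n + 1) =
    -(p ^ (2 * n) * b / ((1 - p ^ (n + 1)) * (1 - b * p ^ n))) * besselCoeff p b n := by
  have h1 := (qPoch_pos hp0.le hp1 hp0.le hp1.le n).ne'
  have h2 := (qPoch_pos hb0.le hb1 hp0.le hp1.le n).ne'
  have h3 := (one_sub_mul_pow_pos hb0.le hb1 hp0.le hp1.le n).ne'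
  have h4 := (one_sub_mul_pow_pos hp0.le hp1 hp0.le hp1.le n).ne'
  -- Subtraction is truncated, so `n = 0` is a separate case; the factor `n` makes the exponent
  -- correct there too.
  have h5 : (n + 1) * (n + 1 - 1) = n * (n - 1) + 2 * n := by
    cases n
    · rfl
    · simp only [Nat.add_sub_cancel]; ring
  rw [besselCoeff, besselCoeff, qPoch_succ, qPoch_succ, h5, pow_succ' p n]
  field_simp
  ring

theorem abs_besselCoeff (n : ℕ) :
    |besselCoeff p b n| = p ^ (n * (n - 1)) * b ^ n / (qPoch p p n * qPoch b p n) := by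
  have h1 := qPoch_pos hp0.le hp1 hp0.le hp1.le n
  have h2 := qPoch_pos hb0.le hb1 hp0.le hp1.le n
  rw [besselCoeff, abs_div, abs_mul, abs_mul, abs_pow, abs_neg, abs_one, one_pow, one_mul,
    abs_of_pos (by positivity : 0 < p ^ (n * (n - 1))), abs_of_pos (pow_pos hb0 n),
    abs_of_pos (mul_pos h1 h2)]

theorem summable_besselCoeff (R : ℝ) (hR : 0 < R) : Summable fun n => |besselCoeff p b n| * R ^ n := by
  refine summable_abs_mul_pow_of_ratio (besselCoeff_ne_zero hp0 hp1 hb0 hb1) ?_ R hR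
  have hp : Tendsto (fun n : ℕ => p ^ n) atTop (𝓝 0) := tendsto_pow_atTop_nhds_zero_of_lt_one hp0.le hp1
  have h : Tendsto (fun n : ℕ => (p ^ n) ^ 2 * b / ((1 - p ^ (n + 1)) * (1 - b * p ^ n))) atTop
      (𝓝 (0 ^ 2 * b / ((1 - 0) * (1 - b * 0)))) :=
    ((hp.pow 2).mul_const b).div (((tendsto_add_atTop_iff_nat 1).2 hp |>.const_sub 1).mul
      ((hp.const_mul b).const_sub 1)) (by simp)
  have h0 : (0 : ℝ) ^ 2 * b / ((1 - 0) * (1 - b * 0)) = 0 := by simp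
  rw [h0] at h
  have h' := h.abs
  rw [abs_zero] at h'
  refine h'.congr fun n => ?_
  rw [besselCoeff_succ hp0 hp1 hb0 hb1, abs_mul, abs_neg, ← pow_mul, mul_comm n 2,
    mul_div_cancel_right₀ _ (abs_ne_zero.2 (besselCoeff_ne_zero hp0 hp1 hb0 hb1 n))]

theorem differentiable_besselSeries : Differentiable ℂ (besselSeries p b) :=
  differentiable_tsum_mul_pow (summable_besselCoeff hp0 hp1 hb0 hb1)

omit hp0 hp1 hb0 hb1 in
theorem conj_besselSeries (x : ℂ) :
    (starRingEnd ℂ) (besselSeries p b x) = besselSeries p b ((starRingEnd ℂ) x) := by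
  rw [besselSeries, besselSeries, Complex.conj_tsum]
  exact tsum_congr fun n => by simp

omit hp0 hp1 hb0 hb1 in
theorem ofReal_re_besselSeries (x : ℝ) : ((besselSeries p b x).re : ℂ) = besselSeries p b x :=
  Complex.conj_eq_iff_re.1 (by rw [conj_besselSeries, Complex.conj_ofReal])

omit hp0 hp1 hb0 hb1 in
theorem besselSeries_zero : besselSeries p b 0 = 1 := by
  rw [besselSeries, tsum_eq_single 0 fun n hn => by simp [hn]]
  simp [besselCoeff_zero]

omit hb0 in
theorem mul_lt_one_of_base : b * p < 1 := by nlinarith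

/-- Both shifted factorials `(bp;p)_n` and `(bpp;p)_n` are rational multiples of `(b;p)_n` by
`qPoch_mul_left`, which leaves a rational identity. -/
theorem besselCoeff_contiguous (n : ℕ) : besselCoeff p b (n + 1) =
    besselCoeff p (b * p) (n + 1) -
      b / ((1 - b) * (1 - b * p)) * besselCoeff p (b * p * p) n := by
  have hbp := mul_lt_one_of_base hp0 hp1 hb1
  have hbp0 : 0 < b * p := mul_pos hb0 hp0
  have h1 := (qPoch_pos hp0.le hp1 hp0.le hp1.le n).ne'
  have h2 := (qPoch_pos hb0.le hb1 hp0.le hp1.le n).ne'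
  have h3 := (one_sub_mul_pow_pos hb0.le hb1 hp0.le hp1.le n).ne'
  have h3' := (one_sub_mul_pow_pos hbp0.le hbp hp0.le hp1.le n).ne'
  have h4 := (one_sub_mul_pow_pos hp0.le hp1 hp0.le hp1.le n).ne'
  have h5 : 1 - b ≠ 0 := by linarith
  have h6 : 1 - b * p ≠ 0 := by linarith
  rw [besselCoeff_succ hp0 hp1 hb0 hb1, besselCoeff_succ hp0 hp1 hbp0 hbp]
  have e1 : qPoch (b * p) p n = qPoch b p n * (1 - b * p ^ n) / (1 - b) := by
    rw [← qPoch_mul_left]; field_simp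
  have e2 : qPoch (b * p * p) p n = qPoch b p n * (1 - b * p ^ n) / (1 - b) *
      (1 - b * p * p ^ n) / (1 - b * p) := by
    rw [← e1, ← qPoch_mul_left]; field_simp
  rw [besselCoeff, besselCoeff, besselCoeff, e1, e2, pow_succ' p n, mul_pow, mul_pow, mul_pow]
  field_simp
  ring

theorem besselSeries_contiguous (x : ℂ) : besselSeries p b x = besselSeries p (b * p) x -
    ((b / ((1 - b) * (1 - b * p)) : ℝ) : ℂ) * x * besselSeries p (b * p * p) x := by
  have hbp := mul_lt_one_of_base hp0 hp1 hb1
  have hbp0 : 0 < b * p := mul_pos hb0 hp0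
  have hbpp := mul_lt_one_of_base hp0 hp1 hbp
  have hbpp0 : 0 < b * p * p := mul_pos hbp0 hp0
  have s1 := summable_mul_pow (summable_besselCoeff hp0 hp1 hb0 hb1) x
  have s2 := summable_mul_pow (summable_besselCoeff hp0 hp1 hbp0 hbp) x
  have s3 := summable_mul_pow (summable_besselCoeff hp0 hp1 hbpp0 hbpp) x
  rw [besselSeries, besselSeries, besselSeries, s1.tsum_eq_zero_add, s2.tsum_eq_zero_add,
    ← tsum_mul_left, add_sub_assoc, ← ((summable_nat_add_iff 1).2 s2).tsum_sub (s3.mul_left _)]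
  rw [besselCoeff_zero, besselCoeff_zero]
  congr 1
  refine tsum_congr fun n => ?_
  rw [besselCoeff_contiguous hp0 hp1 hb0 hb1]
  push_cast
  ring

/-- The numerator gains `(p ^ k) ^ (n + 1) ≤ p ^ k`, and the denominator grows as `b` shrinks. The
index starts at `1` because the constant term does not decay. -/
theorem abs_besselCoeff_mul_pow_le (k n : ℕ) :
    |besselCoeff p (b * p ^ k) (n + 1)| ≤ p ^ k * |besselCoeff p b (n + 1)| := by
  have hk0 : 0 < p ^ k := pow_pos hp0 k
  have hk1 : p ^ k ≤ 1 := pow_le_one₀ hp0.le hp1.le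
  have hbk : b * p ^ k ≤ b := mul_le_of_le_one_right hb0.le hk1
  have h1 := qPoch_pos hp0.le hp1 hp0.le hp1.le (n + 1)
  have h2 := qPoch_pos hb0.le hb1 hp0.le hp1.le (n + 1)
  have h3 := qPoch_anti hbk hb1 hb0.le hp0.le hp1.le (n + 1)
  rw [abs_besselCoeff hp0 hp1 hb0 hb1,
    abs_besselCoeff hp0 hp1 (mul_pos hb0 hk0) (hbk.trans_lt hb1), ← mul_div_assoc]
  have h4 : (b * p ^ k) ^ (n + 1) ≤ p ^ k * b ^ (n + 1) := by
    rw [mul_pow, mul_comm, pow_succ' (p ^ k)]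
    have := pow_le_one₀ hk0.le hk1 (n := n)
    gcongr
    exact mul_le_of_le_one_right hk0.le this
  have h5 : p ^ ((n + 1) * (n + 1 - 1)) * (b * p ^ k) ^ (n + 1) ≤
      p ^ k * (p ^ ((n + 1) * (n + 1 - 1)) * b ^ (n + 1)) := by
    calc _ ≤ p ^ ((n + 1) * (n + 1 - 1)) * (p ^ k * b ^ (n + 1)) := by gcongr
      _ = _ := by ring
  gcongr

theorem exists_norm_besselSeries_sub_one_le (R : ℝ) (hR : 0 < R) :
    ∃ M, ∀ (k : ℕ) (x : ℂ), ‖x‖ ≤ R → ‖besselSeries p (b * p ^ k) x - 1‖ ≤ M * p ^ k := by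
  refine ⟨∑' n, |besselCoeff p b (n + 1)| * R ^ (n + 1), fun k x hx => ?_⟩
  have hk0 : 0 < p ^ k := pow_pos hp0 k
  have hbk : b * p ^ k ≤ b := mul_le_of_le_one_right hb0.le (pow_le_one₀ hp0.le hp1.le)
  have s := summable_mul_pow (summable_besselCoeff hp0 hp1 (mul_pos hb0 hk0) (hbk.trans_lt hb1)) x
  have s' := (summable_nat_add_iff 1).2 (summable_besselCoeff hp0 hp1 hb0 hb1 R hR)
  rw [besselSeries, s.tsum_eq_zero_add, besselCoeff_zero, Complex.ofReal_one, pow_zero, mul_one,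
    add_sub_cancel_left]
  refine tsum_of_norm_bounded (s'.hasSum.mul_right (p ^ k)) fun n => ?_
  rw [norm_mul, norm_pow, Complex.norm_real, Real.norm_eq_abs]
  calc _ ≤ (p ^ k * |besselCoeff p b (n + 1)|) * R ^ (n + 1) := by
        gcongr
        exact abs_besselCoeff_mul_pow_le hp0 hp1 hb0 hb1 k n
    _ = _ := by ring

theorem tendsto_besselSeries (x : ℂ) :
    Tendsto (fun k => besselSeries p (b * p ^ k) x) atTop (𝓝 1) := by
  obtain ⟨M, hM⟩ := exists_norm_besselSeries_sub_one_le hp0 hp1 hb0 hb1 (‖x‖ + 1) (by positivity)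
  rw [tendsto_iff_norm_sub_tendsto_zero]
  refine squeeze_zero (fun _ => norm_nonneg _) (fun k => hM k x (by simp)) ?_
  simpa using (tendsto_pow_atTop_nhds_zero_of_lt_one hp0.le hp1).const_mul M

theorem tendsto_deriv_besselSeries (x : ℂ) :
    Tendsto (fun k => deriv (besselSeries p (b * p ^ k)) x) atTop (𝓝 0) := by
  obtain ⟨M, hM⟩ := exists_norm_besselSeries_sub_one_le hp0 hp1 hb0 hb1 (‖x‖ + 1) (by positivity)
  refine squeeze_zero_norm (a := fun k => M * p ^ k) (fun k => ?_) (by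
    simpa using (tendsto_pow_atTop_nhds_zero_of_lt_one hp0.le hp1).const_mul M)
  have hk0 : 0 < p ^ k := pow_pos hp0 k
  have hbk : b * p ^ k ≤ b := mul_le_of_le_one_right hb0.le (pow_le_one₀ hp0.le hp1.le)
  have hd := differentiable_besselSeries hp0 hp1 (mul_pos hb0 hk0) (hbk.trans_lt hb1)
  -- Cauchy's estimate on the unit circle about `x` transfers the uniform bound to the derivative.
  have := Complex.norm_deriv_le_of_forall_mem_sphere_norm_le
    (f := fun y => besselSeries p (b * p ^ k) y - 1) (c := x) (C := M * p ^ k) one_pos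
    (hd.sub_const 1).diffContOnCl fun y hy => hM k y (by
      have h1 : ‖y - x‖ = 1 := by simpa using hy
      have := norm_add_le x (y - x)
      rw [add_sub_cancel, h1] at this
      exact this)
  simpa [deriv_sub_const] using this

end

/-! ### Zeros of the power series -/

/-- Induction downwards from infinite order, the substitute for a base case in the sign arguments
below. -/
theorem forall_of_eventually_of_step {P : ℕ → Prop} (hP : ∀ᶠ k in atTop, P k)
    (h : ∀ k, P (k + 1) → P (k + 2) → P k) (k : ℕ) : P k := by
  obtain ⟨N, hN⟩ := eventually_atTop.1 hP
  have key : ∀ m k, N ≤ k + m → P k := by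
    intro m
    induction m with
    | zero => exact fun k hk => hN k hk
    | succ m ih => exact fun k hk => h k (ih _ (by omega)) (ih _ (by omega))
  exact key N k (by omega)

/-- The coefficients of the three-term recurrence in the order of the Bessel function. -/
noncomputable def lommelCoeff (p b : ℝ) (k : ℕ) : ℝ :=
  b * p ^ k / ((1 - b * p ^ k) * (1 - b * p ^ k * p))

/-- The restriction of `besselSeries` to the real line. -/
noncomputable def besselReal (p b x : ℝ) : ℝ := (besselSeries p b x).re

section

variable {p b : ℝ} (hp0 : 0 < p) (hp1 : p < 1) (hb0 : 0 < b) (hb1 : b < 1)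

theorem besselSeries_ofReal (x : ℝ) : besselSeries p b x = besselReal p b x :=
  (ofReal_re_besselSeries x).symm

theorem besselSeries_ofReal_eq_zero_iff {x : ℝ} : besselSeries p b x = 0 ↔ besselReal p b x = 0 := by
  rw [besselSeries_ofReal, Complex.ofReal_eq_zero]

theorem besselReal_zero : besselReal p b 0 = 1 := by
  simp [besselReal, besselSeries_zero]

include hp0 hp1 hb0 hb1

omit hp1 hb1 in
theorem base_mul_pow_pos (k : ℕ) : 0 < b * p ^ k := mul_pos hb0 (pow_pos hp0 k)

theorem base_mul_pow_lt_one (k : ℕ) : b * p ^ k < 1 :=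
  (mul_le_of_le_one_right hb0.le (pow_le_one₀ hp0.le hp1.le)).trans_lt hb1

theorem lommelCoeff_pos (k : ℕ) : 0 < lommelCoeff p b k := by
  have h0 := base_mul_pow_pos hp0 hb0 k
  have h1 := base_mul_pow_lt_one hp0 hp1 hb0 hb1 k
  have h2 := mul_lt_one_of_base hp0 hp1 h1
  exact div_pos h0 (mul_pos (by linarith) (by linarith))

theorem besselSeries_recurrence (k : ℕ) (x : ℂ) : besselSeries p (b * p ^ k) x =
    besselSeries p (b * p ^ (k + 1)) x -
      (lommelCoeff p b k : ℂ) * x * besselSeries p (b * p ^ (k + 2)) x := by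
  rw [besselSeries_contiguous hp0 hp1 (base_mul_pow_pos hp0 hb0 k)
    (base_mul_pow_lt_one hp0 hp1 hb0 hb1 k), lommelCoeff, pow_succ, pow_succ, pow_succ]
  simp only [mul_assoc]

theorem differentiable_besselSeries_mul_pow (k : ℕ) : Differentiable ℂ (besselSeries p (b * p ^ k)) :=
  differentiable_besselSeries hp0 hp1 (base_mul_pow_pos hp0 hb0 k)
    (base_mul_pow_lt_one hp0 hp1 hb0 hb1 k)

theorem deriv_besselSeries_recurrence (k : ℕ) (x : ℂ) : deriv (besselSeries p (b * p ^ k)) x =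
    deriv (besselSeries p (b * p ^ (k + 1))) x -
      (lommelCoeff p b k : ℂ) * (besselSeries p (b * p ^ (k + 2)) x +
        x * deriv (besselSeries p (b * p ^ (k + 2))) x) := by
  have h : ∀ k, HasDerivAt (besselSeries p (b * p ^ k)) (deriv (besselSeries p (b * p ^ k)) x) x :=
    fun k => (differentiable_besselSeries_mul_pow hp0 hp1 hb0 hb1 k x).hasDerivAt
  have h1 := (h (k + 1)).sub
    (((hasDerivAt_id x).const_mul (lommelCoeff p b k : ℂ)).mul (h (k + 2)))
  have h2 : besselSeries p (b * p ^ k) = besselSeries p (b * p ^ (k + 1)) -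
      (fun y => (lommelCoeff p b k : ℂ) * id y) * besselSeries p (b * p ^ (k + 2)) :=
    funext fun y => besselSeries_recurrence hp0 hp1 hb0 hb1 k y
  rw [← h2] at h1
  rw [h1.deriv]
  simp only [id]
  ring

theorem besselReal_recurrence (k : ℕ) (x : ℝ) : besselReal p (b * p ^ k) x =
    besselReal p (b * p ^ (k + 1)) x -
      lommelCoeff p b k * x * besselReal p (b * p ^ (k + 2)) x := by
  rw [besselReal, besselSeries_recurrence hp0 hp1 hb0 hb1, ← Complex.ofReal_mul, Complex.sub_re,
    Complex.re_ofReal_mul]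
  rfl

theorem hasDerivAt_besselReal (x : ℝ) :
    HasDerivAt (besselReal p b) (deriv (besselSeries p b) x).re x :=
  (differentiable_besselSeries hp0 hp1 hb0 hb1 x).hasDerivAt.real_of_complex

theorem tendsto_besselReal (x : ℝ) :
    Tendsto (fun k => besselReal p (b * p ^ k) x) atTop (𝓝 1) := by
  simpa [Function.comp_def, besselReal] using (Complex.continuous_re.tendsto 1).comp (tendsto_besselSeries hp0 hp1 hb0 hb1 x)

/-- With `u_k` the value at order shift `k`, the quantity `Im (x u_{k+1} conj u_k)` tends to `Im x >
0`. Two uses of the recurrence write it as a nonnegative term plus a positive multiple of the same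
quantity at `k + 2`, so it is positive at `k = 0`, where a zero would kill it. -/
theorem besselSeries_ne_zero_of_im_pos {x : ℂ} (hx : 0 < x.im) : besselSeries p b x ≠ 0 := by
  have hx0 : x ≠ 0 := by rintro rfl; simp at hx
  have key := forall_of_eventually_of_step (P := fun k => 0 < (x * besselSeries p (b * p ^ (k + 1)) x *
    (starRingEnd ℂ) (besselSeries p (b * p ^ k) x)).im) ?_ (fun k _ h2 => ?_) 0
  · intro h0
    simp [h0] at key
  · have h := tendsto_besselSeries hp0 hp1 hb0 hb1 x
    have h' := (Complex.continuous_im.tendsto _).comp ((((tendsto_add_atTop_iff_nat 1).2 h).const_mul x).mul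
      ((Complex.continuous_conj.tendsto _).comp h))
    exact h'.eventually (lt_mem_nhds (by simpa using hx))
  · have r0 := besselSeries_recurrence hp0 hp1 hb0 hb1 k x
    have r1 := besselSeries_recurrence hp0 hp1 hb0 hb1 (k + 1) x
    have ha := lommelCoeff_pos hp0 hp1 hb0 hb1 k
    have ha' := lommelCoeff_pos hp0 hp1 hb0 hb1 (k + 1)
    simp only [add_assoc, Nat.reduceAdd] at r1 h2
    generalize besselSeries p (b * p ^ k) x = u0 at *
    generalize besselSeries p (b * p ^ (k + 1)) x = u1 at *
    generalize besselSeries p (b * p ^ (k + 2)) x = u2 at *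
    generalize besselSeries p (b * p ^ (k + 3)) x = u3 at *
    generalize lommelCoeff p b k = a at *
    generalize lommelCoeff p b (k + 1) = a' at *
    have e : (x * u1 * (starRingEnd ℂ) u0).im = x.im * Complex.normSq u1 +
        a * a' * Complex.normSq x * (x * u3 * (starRingEnd ℂ) u2).im := by
      have e1 : (x * u1 * (starRingEnd ℂ) u0).im = x.im * Complex.normSq u1 -
          a * Complex.normSq x * (u1 * (starRingEnd ℂ) u2).im := by
        rw [r0]
        simp [Complex.normSq_apply]
        ring
      have e2 : (u1 * (starRingEnd ℂ) u2).im = -(a' * (x * u3 * (starRingEnd ℂ) u2).im) := by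
        rw [r1]
        simp
        ring
      rw [e1, e2]
      ring
    rw [e]
    have := Complex.normSq_nonneg u1
    have := Complex.normSq_pos.2 hx0
    positivity

theorem besselReal_pos_of_neg {x : ℝ} (hx : x < 0) : 0 < besselReal p b x := by
  have key := forall_of_eventually_of_step (P := fun k => 0 < besselReal p (b * p ^ k) x)
    ((tendsto_besselReal hp0 hp1 hb0 hb1 x).eventually (lt_mem_nhds one_pos)) (fun k h1 h2 => ?_) 0
  · simpa using key
  · rw [besselReal_recurrence hp0 hp1 hb0 hb1]
    have := mul_pos (mul_pos (lommelCoeff_pos hp0 hp1 hb0 hb1 k) (neg_pos.2 hx)) h2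
    linarith

theorem exists_pos_of_besselSeries_eq_zero {x : ℂ} (h : besselSeries p b x = 0) :
    ∃ y : ℝ, 0 < y ∧ x = y := by
  have him : x.im = 0 := by
    rcases lt_trichotomy x.im 0 with h1 | h1 | h1
    · refine absurd ?_ (besselSeries_ne_zero_of_im_pos hp0 hp1 hb0 hb1
        (x := (starRingEnd ℂ) x) (by simpa using h1))
      rw [← conj_besselSeries, h, map_zero]
    · exact h1
    · exact absurd h (besselSeries_ne_zero_of_im_pos hp0 hp1 hb0 hb1 h1)
  have hx : x = (x.re : ℂ) := Complex.ext rfl (by simpa using him)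
  refine ⟨x.re, ?_, hx⟩
  rw [hx, besselSeries_ofReal_eq_zero_iff] at h
  rcases lt_trichotomy x.re 0 with h1 | h1 | h1
  · exact absurd h (besselReal_pos_of_neg hp0 hp1 hb0 hb1 h1).ne'
  · rw [h1, besselReal_zero] at h
    exact absurd h one_ne_zero
  · exact h1

/-- The expression `W_k` at shift `k` tends to `1` and satisfies `W_k = u_{k+1}^2 + λ_k λ_{k+1} x^2
W_{k+2}`. It is also the numerator of the derivative of `x u_1 / u_0`, and it vanishes at a double
zero of `u_0`. -/
theorem besselReal_wronskian_pos {x : ℝ} (hx : 0 < x) :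
    0 < besselReal p b x * besselReal p (b * p) x -
      x * (deriv (besselReal p b) x * besselReal p (b * p) x -
        besselReal p b x * deriv (besselReal p (b * p)) x) := by
  have hd : ∀ k, deriv (besselReal p (b * p ^ k)) x = (deriv (besselSeries p (b * p ^ k)) x).re :=
    fun k => (hasDerivAt_besselReal hp0 hp1 (base_mul_pow_pos hp0 hb0 k)
      (base_mul_pow_lt_one hp0 hp1 hb0 hb1 k) x).deriv
  have rd : ∀ k, deriv (besselReal p (b * p ^ k)) x = deriv (besselReal p (b * p ^ (k + 1))) x -
      lommelCoeff p b k * (besselReal p (b * p ^ (k + 2)) x +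
        x * deriv (besselReal p (b * p ^ (k + 2))) x) := by
    intro k
    rw [hd, hd, hd, deriv_besselSeries_recurrence hp0 hp1 hb0 hb1, Complex.sub_re,
      Complex.re_ofReal_mul, Complex.add_re, Complex.re_ofReal_mul]
    rfl
  have key := forall_of_eventually_of_step (P := fun k => 0 < besselReal p (b * p ^ k) x *
    besselReal p (b * p ^ (k + 1)) x -
      x * (deriv (besselReal p (b * p ^ k)) x * besselReal p (b * p ^ (k + 1)) x -
        besselReal p (b * p ^ k) x * deriv (besselReal p (b * p ^ (k + 1))) x)) ?_
        (fun k _ h2 => ?_) 0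
  · simpa using key
  · have h := tendsto_besselReal hp0 hp1 hb0 hb1 x
    have h' : Tendsto (fun k => deriv (besselReal p (b * p ^ k)) x) atTop (𝓝 0) := by
      simp only [hd]
      simpa [Function.comp_def] using (Complex.continuous_re.tendsto 0).comp
        (tendsto_deriv_besselSeries hp0 hp1 hb0 hb1 x)
    have s := (tendsto_add_atTop_iff_nat 1).2 h
    have s' := (tendsto_add_atTop_iff_nat 1).2 h'
    exact ((h.mul s).sub (((h'.mul s).sub (h.mul s')).const_mul x)).eventually
      (lt_mem_nhds (by norm_num))
  · have r0 := besselReal_recurrence hp0 hp1 hb0 hb1 k x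
    have r1 := besselReal_recurrence hp0 hp1 hb0 hb1 (k + 1) x
    have d0 := rd k
    have d1 := rd (k + 1)
    have ha := lommelCoeff_pos hp0 hp1 hb0 hb1 k
    have ha' := lommelCoeff_pos hp0 hp1 hb0 hb1 (k + 1)
    simp only [add_assoc, Nat.reduceAdd] at r1 d1 h2
    generalize deriv (besselReal p (b * p ^ k)) x = v0 at *
    generalize deriv (besselReal p (b * p ^ (k + 1))) x = v1 at *
    generalize deriv (besselReal p (b * p ^ (k + 2))) x = v2 at *
    generalize deriv (besselReal p (b * p ^ (k + 3))) x = v3 at *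
    generalize besselReal p (b * p ^ k) x = u0 at *
    generalize besselReal p (b * p ^ (k + 1)) x = u1 at *
    generalize besselReal p (b * p ^ (k + 2)) x = u2 at *
    generalize besselReal p (b * p ^ (k + 3)) x = u3 at *
    generalize lommelCoeff p b k = a at *
    generalize lommelCoeff p b (k + 1) = a' at *
    have e : u0 * u1 - x * (v0 * u1 - u0 * v1) =
        u1 ^ 2 + a * a' * x ^ 2 * (u2 * u3 - x * (v2 * u3 - u2 * v3)) := by
      rw [r0, d0, d1, r1]
      ring
    rw [e]
    positivity

theorem deriv_besselReal_ne_zero {x : ℝ} (hx : 0 < x) (h : besselReal p b x = 0) :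
    deriv (besselReal p b) x ≠ 0 := by
  intro h'
  have := besselReal_wronskian_pos hp0 hp1 hb0 hb1 hx
  simp [h, h'] at this

theorem continuous_besselReal : Continuous (besselReal p b) :=
  continuous_iff_continuousAt.2 fun x => (hasDerivAt_besselReal hp0 hp1 hb0 hb1 x).continuousAt

/-- The quotient `x u_1 / u_0` vanishes at `0` and increases strictly by the Wronskian inequality,
so `u_1` inherits positivity from `u_0`. -/
theorem besselReal_mul_base_pos (h : ∀ x, 0 < x → 0 < besselReal p b x) (x : ℝ) (hx : 0 < x) :
    0 < besselReal p (b * p) x := by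
  have hbp := mul_lt_one_of_base hp0 hp1 hb1
  have hbp0 : 0 < b * p := mul_pos hb0 hp0
  have h' : ∀ x, 0 ≤ x → 0 < besselReal p b x := fun x hx => hx.eq_or_lt.elim
    (fun e => by rw [← e, besselReal_zero]; exact one_pos) (h x)
  have hmono : StrictMonoOn (fun x => x * besselReal p (b * p) x / besselReal p b x) (Set.Ici 0) := by
    refine strictMonoOn_of_deriv_pos (convex_Ici 0) ?_ fun y hy => ?_
    · exact (continuous_id.mul (continuous_besselReal hp0 hp1 hbp0 hbp)).continuousOn.div
        (continuous_besselReal hp0 hp1 hb0 hb1).continuousOn fun y hy => (h' y hy).ne'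
    · rw [interior_Ici, Set.mem_Ioi] at hy
      have d0 := (hasDerivAt_besselReal hp0 hp1 hb0 hb1 y).differentiableAt.hasDerivAt
      have d1 := (hasDerivAt_besselReal hp0 hp1 hbp0 hbp y).differentiableAt.hasDerivAt
      have hw := besselReal_wronskian_pos hp0 hp1 hb0 hb1 hy
      rw [(((hasDerivAt_id' y).fun_mul d1).fun_div d0 (h y hy).ne').deriv]
      refine div_pos ?_ (pow_pos (h y hy) 2)
      linarith
  have := hmono Set.self_mem_Ici hx.le hx
  simp only [zero_mul, zero_div] at this
  exact (pos_iff_pos_of_mul_pos ((div_pos_iff_of_pos_right (h x hx)).1 this)).1 hx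

theorem exists_besselReal_eq_zero : ∃ x, 0 < x ∧ besselReal p b x = 0 := by
  by_contra! hne
  have hpos : ∀ x, 0 < x → 0 < besselReal p b x := by
    intro x hx
    by_contra! hle
    obtain ⟨y, hy, hy0⟩ := intermediate_value_Icc' hx.le
      (continuous_besselReal hp0 hp1 hb0 hb1).continuousOn
      (show (0 : ℝ) ∈ Set.Icc _ _ from ⟨hle, by rw [besselReal_zero]; exact zero_le_one⟩)
    rcases hy.1.eq_or_lt with rfl | h
    · rw [besselReal_zero] at hy0
      exact one_ne_zero hy0
    · exact hne y h hy0
  have hall : ∀ k x, 0 < x → 0 < besselReal p (b * p ^ k) x := by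
    intro k
    induction k with
    | zero => simpa using hpos
    | succ k ih =>
      rw [pow_succ, ← mul_assoc]
      exact besselReal_mul_base_pos hp0 hp1 (base_mul_pow_pos hp0 hb0 k)
        (base_mul_pow_lt_one hp0 hp1 hb0 hb1 k) ih
  have ha := lommelCoeff_pos hp0 hp1 hb0 hb1 0
  have ha1 := lommelCoeff_pos hp0 hp1 hb0 hb1 1
  -- At this point `λ_0 x = 1`, so `u_0 = u_1 - u_2 = -λ_1 x u_3`, which contradicts positivity at
  -- every order.
  have hx : 0 < (lommelCoeff p b 0)⁻¹ := inv_pos.2 ha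
  have r0 := besselReal_recurrence hp0 hp1 hb0 hb1 0 (lommelCoeff p b 0)⁻¹
  have r1 := besselReal_recurrence hp0 hp1 hb0 hb1 1 (lommelCoeff p b 0)⁻¹
  rw [mul_inv_cancel₀ ha.ne', one_mul] at r0
  have := hall 0 _ hx
  have := mul_pos (mul_pos ha1 hx) (hall 3 _ hx)
  simp only [Nat.reduceAdd] at r0 r1
  linarith

/-- The zero of smallest modulus is positive and simple, and no other zero has the same modulus. -/
theorem exists_isLeast_besselSeries_zero : ∃ y : ℝ,
    IsLeast {x : ℝ | 0 < x ∧ besselSeries p b x = 0} y ∧ deriv (besselSeries p b) y ≠ 0 ∧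
      ∃ y' > y, ∀ x : ℂ, ‖x‖ < y' → besselSeries p b x = 0 → x = y := by
  obtain ⟨x₁, hx₁, hx₁0⟩ := exists_besselReal_eq_zero hp0 hp1 hb0 hb1
  -- The value at `0` is `1`, so admitting `0` changes nothing and makes the set closed; its infimum
  -- is then attained.
  have hcl : {x : ℝ | 0 < x ∧ besselSeries p b x = 0} = {x : ℝ | 0 ≤ x ∧ besselReal p b x = 0} := by
    ext x
    simp only [Set.mem_ofPred_eq, besselSeries_ofReal_eq_zero_iff]
    refine ⟨fun h => ⟨h.1.le, h.2⟩, fun h => ⟨h.1.lt_of_ne' ?_, h.2⟩⟩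
    rintro rfl
    exact one_ne_zero (besselReal_zero.symm.trans h.2)
  have hleast : IsLeast {x : ℝ | 0 < x ∧ besselSeries p b x = 0}
      (sInf {x : ℝ | 0 < x ∧ besselSeries p b x = 0}) := by
    rw [hcl]
    refine IsClosed.isLeast_csInf ?_ ⟨x₁, hx₁.le, hx₁0⟩ ⟨0, fun x hx => hx.1⟩
    exact isClosed_Ici.inter (isClosed_singleton.preimage (continuous_besselReal hp0 hp1 hb0 hb1))
  generalize sInf {x : ℝ | 0 < x ∧ besselSeries p b x = 0} = y at hleast
  obtain ⟨hy, hy0⟩ := hleast.1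
  have hd := hasDerivAt_besselReal hp0 hp1 hb0 hb1 y
  have hne := deriv_besselReal_ne_zero hp0 hp1 hb0 hb1 hy (besselSeries_ofReal_eq_zero_iff.1 hy0)
  refine ⟨y, hleast, fun h => hne (by rw [hd.deriv, h, Complex.zero_re]), ?_⟩
  -- A simple zero is isolated. Only the right side matters, since every zero is a positive real and
  -- none lies below `y`.
  have hev := hd.differentiableAt.hasDerivAt.eventually_ne (c := 0) hne
  have hev' : ∀ᶠ x in 𝓝[>] y, besselReal p b x ≠ 0 :=
    hev.filter_mono (nhdsWithin_mono _ fun x hx => ne_of_gt hx)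
  obtain ⟨y', hy', hIoo⟩ := mem_nhdsGT_iff_exists_Ioo_subset.1 hev'
  refine ⟨y', hy', fun x hx hx0 => ?_⟩
  obtain ⟨t, ht, rfl⟩ := exists_pos_of_besselSeries_eq_zero hp0 hp1 hb0 hb1 hx0
  rw [Complex.norm_real, Real.norm_of_nonneg ht.le] at hx
  rcases (hleast.2 ⟨ht, hx0⟩).eq_or_lt with h | h
  · rw [h]
  · exact absurd (besselSeries_ofReal_eq_zero_iff.1 hx0) (hIoo ⟨h, hx⟩)

end

/-! ### Taylor coefficients of a function with two opposite simple poles -/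

theorem iteratedDeriv_inv_sub_zero (s : ℂ) (n : ℕ) :
    iteratedDeriv n (fun t : ℂ => (t - s)⁻¹) 0 = -(n.factorial / s ^ (n + 1)) := by
  have h := congrFun (iter_deriv_inv_linear_sub n (1 : ℂ) s) 0
  simp only [one_mul, one_pow, mul_one, zero_sub] at h
  rw [iteratedDeriv_eq_iterate, h, show (-1 - n : ℤ) = -((n + 1 : ℕ) : ℤ) by push_cast; ring,
    zpow_neg, zpow_natCast, neg_pow s, mul_inv, ← inv_pow, inv_neg, inv_one, pow_succ (-1 : ℂ) n]
  have h1 : (-1 : ℂ) ^ n * (-1) ^ n = 1 := by rw [← mul_pow]; simp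
  linear_combination (-(n.factorial : ℂ) * (s ^ (n + 1))⁻¹) * h1

theorem exists_taylorCoeff_eq_of_two_poles {K f : ℂ → ℂ} {s : ℂ} {R : ℝ} (hs : s ≠ 0) (hsR : ‖s‖ < R)
    (hK : DifferentiableOn ℂ K (Metric.ball 0 R))
    (hf : ∀ t, f t = K t / ((t - s) * (t + s))) :
    ∃ ε : ℕ → ℂ, Tendsto (fun n => ε n * s ^ n) atTop (𝓝 0) ∧
      ∀ n, iteratedDeriv n f 0 / n.factorial =
        -(K s + (-1) ^ n * K (-s)) / (2 * s ^ (n + 2)) + ε n := by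
  have hmem : ∀ {t : ℂ}, ‖t‖ < R → Metric.ball (0 : ℂ) R ∈ 𝓝 t := fun h =>
    Metric.isOpen_ball.mem_nhds (mem_ball_zero_iff.2 h)
  have hR : 0 < R := (norm_nonneg s).trans_lt hsR
  set H := dslope (dslope K s) (-s) with hHdef
  have hH : DifferentiableOn ℂ H (Metric.ball 0 R) :=
    (Complex.differentiableOn_dslope (hmem (by rwa [norm_neg]))).2
      ((Complex.differentiableOn_dslope (hmem hsR)).2 hK)
  have hK1 : ∀ t, (t - s) * dslope K s t = K t - K s := fun t => by
    simpa using sub_smul_dslope K s t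
  have hK2 : ∀ t, (t + s) * H t = dslope K s t - dslope K s (-s) := fun t => by
    simpa using sub_smul_dslope (dslope K s) (-s) t
  have hKs : dslope K s (-s) = -(K (-s) - K s) / (2 * s) := by
    rw [← hK1]
    field_simp
    ring
  have hfH : f =ᶠ[𝓝 0] fun t =>
      H t + (K s / (2 * s) * (t - s)⁻¹ + -(K (-s) / (2 * s)) * (t - -s)⁻¹) := by
    filter_upwards [Metric.ball_mem_nhds (0 : ℂ) (norm_pos_iff.2 hs)] with t ht
    rw [mem_ball_zero_iff] at ht
    have h1 : t - s ≠ 0 := by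
      intro h
      rw [sub_eq_zero.1 h] at ht
      exact lt_irrefl _ ht
    have h2 : t + s ≠ 0 := by
      intro h
      rw [eq_neg_of_add_eq_zero_left h, norm_neg] at ht
      exact lt_irrefl _ ht
    have e : K t = K s + (t - s) * (-(K (-s) - K s) / (2 * s) + (t + s) * H t) := by
      rw [hK2, ← hKs]
      linear_combination -hK1 t
    rw [hf, e, sub_neg_eq_add]
    field_simp
    ring
  have hHc : ∀ n : ℕ, ContDiffAt ℂ n H 0 := fun n =>
    (hH.analyticAt (Metric.ball_mem_nhds _ hR)).contDiffAt
  have hinv : ∀ {u : ℂ} (n : ℕ), u ≠ 0 → ContDiffAt ℂ n (fun t : ℂ => (t - u)⁻¹) 0 := fun n hu =>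
    (contDiffAt_id.sub contDiffAt_const).inv (by simpa using hu)
  refine ⟨fun n => iteratedDeriv n H 0 / n.factorial, ?_, fun n => ?_⟩
  · have := (Complex.hasSum_taylorSeries_on_ball hH
      (mem_ball_zero_iff.2 hsR)).summable.tendsto_atTop_zero
    refine this.congr fun n => ?_
    simp only [sub_zero, smul_eq_mul]
    ring
  · have hs' : -s ≠ 0 := neg_ne_zero.2 hs
    rw [hfH.iteratedDeriv_eq, iteratedDeriv_fun_add (hHc n)
      ((contDiffAt_const.mul (hinv n hs)).add (contDiffAt_const.mul (hinv n hs'))),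
      iteratedDeriv_fun_add (contDiffAt_const.mul (hinv n hs)) (contDiffAt_const.mul (hinv n hs')),
      iteratedDeriv_const_mul_field, iteratedDeriv_const_mul_field, iteratedDeriv_inv_sub_zero,
      iteratedDeriv_inv_sub_zero, neg_pow s]
    have hn : (n.factorial : ℂ) ≠ 0 := Nat.cast_ne_zero.2 n.factorial_ne_zero
    rcases neg_one_pow_eq_or ℂ n with h | h <;> rw [pow_succ (-1 : ℂ), h] <;> field_simp <;> ring

/-! ### The `q`-exponential function -/

theorem differentiable_bigE {q : ℝ} (hq0 : 0 < q) (hq1 : q < 1) : Differentiable ℂ (bigE q) := by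
  set a : ℕ → ℝ := fun n => q ^ (n * (n - 1) / 2) * (1 - q) ^ n / qPoch q q n with ha
  have hq : 0 < 1 - q := by linarith
  have hpos : ∀ n, 0 < a n := fun n => by
    have := qPoch_pos hq0.le hq1 hq0.le hq1.le n
    positivity
  have hsucc : ∀ n, a (n + 1) / a n = q ^ n * (1 - q) / (1 - q * q ^ n) := by
    intro n
    have h1 := (qPoch_pos hq0.le hq1 hq0.le hq1.le n).ne'
    have h2 := (one_sub_mul_pow_pos hq0.le hq1 hq0.le hq1.le n).ne'
    -- The exponent is a natural-number quotient; the increment `n * 2` is even, so it passes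
    -- through the division exactly.
    have h3 : (n + 1) * (n + 1 - 1) / 2 = n * (n - 1) / 2 + n := by
      have : (n + 1) * (n + 1 - 1) = n * (n - 1) + n * 2 := by
        cases n
        · rfl
        · simp only [Nat.add_sub_cancel]; ring
      rw [this, Nat.add_mul_div_right _ _ two_pos]
    have h4 : 1 - q ≠ 0 := hq.ne'
    simp only [ha]
    rw [qPoch_succ, h3, pow_add]
    field_simp
    ring
  have hlim : Tendsto (fun n => |a (n + 1)| / |a n|) atTop (𝓝 0) := by
    have hp := tendsto_pow_atTop_nhds_zero_of_lt_one hq0.le hq1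
    have h := (hp.mul_const (1 - q)).div ((hp.const_mul q).const_sub 1) (by simp)
    rw [zero_mul, zero_div] at h
    refine h.congr fun n => ?_
    rw [abs_of_pos (hpos _), abs_of_pos (hpos _), hsucc]
    rfl
  have hE : bigE q = fun z => ∑' n, (a n : ℂ) * z ^ n := by
    funext z
    refine tsum_congr fun n => ?_
    simp only [ha]
    push_cast
    rw [mul_pow]
    ring
  rw [hE]
  exact differentiable_tsum_mul_pow
    (summable_abs_mul_pow_of_ratio (fun n => (hpos n).ne') hlim)

theorem bigE_neg_I_mul (q : ℝ) (z : ℂ) :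
    bigE q (-(Complex.I * z)) = bigCos q z - Complex.I * bigSin q z := by
  have := Complex.I_ne_zero
  unfold bigCos bigSin
  field_simp
  ring

/-! ### The modified Bessel function and its first zero -/

theorem modBessel2_eq_besselSeries {α p : ℝ} (hp0 : 0 < p) (w : ℂ) :
    modBessel2 α p w = besselSeries p (p ^ (α + 1)) ((w / 2) ^ 2) := by
  refine tsum_congr fun n => ?_
  have h : p ^ ((n : ℝ) * (α + n)) = p ^ (n * (n - 1)) * (p ^ (α + 1)) ^ n := by
    rw [← Real.rpow_natCast, ← Real.rpow_natCast, ← Real.rpow_mul hp0.le, ← Real.rpow_add hp0]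
    congr 1
    cases n
    · simp
    · simp only [Nat.add_sub_cancel]; push_cast; ring
  rw [h, besselCoeff, pow_mul (w / 2) 2 n]
  generalize (w / 2) ^ 2 = x
  push_cast
  ring

theorem jacksonBessel2_ofReal_eq_zero_iff {α p : ℝ} (hα : -1 < α) (hp0 : 0 < p) (hp1 : p < 1) {x : ℝ}
    (hx : 0 < x) : jacksonBessel2 α p x = 0 ↔
      besselSeries p (p ^ (α + 1)) (((x / 2) ^ 2 : ℝ) : ℂ) = 0 := by
  have hx0 : (x : ℂ) ≠ 0 := Complex.ofReal_ne_zero.2 hx.ne'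
  have h1 := qPochInf_ne_zero hp0 hp1 hp0 hp1
  have h2 := qPochInf_ne_zero (Real.rpow_pos_of_pos hp0 (α + 1))
    (Real.rpow_lt_one hp0.le hp1 (by linarith)) hp0 hp1
  have h3 : ((x : ℂ) / 2) ^ (-(α : ℂ)) ≠ 0 := by
    rw [Ne, Complex.cpow_eq_zero_iff]
    exact fun h => div_ne_zero hx0 two_ne_zero h.1
  have h := modBessel2_eq hα hp0 hp1 hx0
  rw [modBessel2_eq_besselSeries hp0] at h
  push_cast
  rw [h, mul_eq_zero, or_iff_right]
  exact mul_ne_zero (Complex.ofReal_ne_zero.2 (div_ne_zero h1 h2)) h3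

theorem isLeast_jacksonBessel2_zero {α p y : ℝ} (hα : -1 < α) (hp0 : 0 < p) (hp1 : p < 1)
    (hy : IsLeast {x : ℝ | 0 < x ∧ besselSeries p (p ^ (α + 1)) x = 0} y) :
    IsLeast {x : ℝ | 0 < x ∧ jacksonBessel2 α p (x : ℂ) = 0} (2 * √y) := by
  have hy0 : 0 < √y := Real.sqrt_pos.2 hy.1.1
  refine ⟨⟨by positivity, ?_⟩, fun x hx => ?_⟩
  · rw [jacksonBessel2_ofReal_eq_zero_iff hα hp0 hp1 (by positivity),
      mul_div_cancel_left₀ _ two_ne_zero, Real.sq_sqrt hy.1.1.le]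
    exact hy.1.2
  · have h := hy.2 ⟨by have := hx.1; positivity,
      (jacksonBessel2_ofReal_eq_zero_iff hα hp0 hp1 hx.1).1 hx.2⟩
    have := Real.sqrt_le_sqrt h
    rw [Real.sqrt_sq (by linarith [hx.1])] at this
    linarith

theorem deriv_modBessel2 {α p : ℝ} (hα : -1 < α) (hp0 : 0 < p) (hp1 : p < 1) (w : ℂ) :
    deriv (modBessel2 α p) w =
      deriv (besselSeries p (p ^ (α + 1))) ((w / 2) ^ 2) * (w / 2) := by
  have hd := differentiable_besselSeries hp0 hp1 (Real.rpow_pos_of_pos hp0 (α + 1))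
    (Real.rpow_lt_one hp0.le hp1 (by linarith))
  have h1 : HasDerivAt (fun w : ℂ => (w / 2) ^ 2) (w / 2) w := by
    have := ((hasDerivAt_id' w).div_const 2).pow 2
    refine this.congr_deriv ?_
    norm_num
    ring
  rw [funext (modBessel2_eq_besselSeries (α := α) hp0)]
  exact ((hd _).hasDerivAt.comp w h1).deriv

/-! ### The generating function -/

/-- Factoring `φ x = (x - y) ψ x` with `x = -((1 - q) t / 2) ^ 2` gives `x - y = -((1 - q) ^ 2 / 4)
(t ^ 2 + 4 ζ ^ 2)`. The numerator `K` absorbs `1 / ψ`, and at the poles `ψ` equals `φ' y`. -/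
theorem exists_genFun_eq {α q y y' ζ : ℝ} (hα : -1 < α) (hq0 : 0 < q) (hq1 : q < 1) (hζ : 0 < ζ)
    (hyζ : y = (ζ * (1 - q)) ^ 2)
    (hy : besselSeries (q ^ 2) ((q ^ 2) ^ (α + 1)) y = 0)
    (hdy : deriv (besselSeries (q ^ 2) ((q ^ 2) ^ (α + 1))) y ≠ 0) (hyy' : y < y')
    (huniq : ∀ x : ℂ, ‖x‖ < y' → besselSeries (q ^ 2) ((q ^ 2) ^ (α + 1)) x = 0 → x = y) (z : ℂ) :
    ∃ (K : ℂ → ℂ) (R : ℝ), 2 * ζ < R ∧ DifferentiableOn ℂ K (Metric.ball 0 R) ∧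
      (∀ t, genFun α q z t =
        K t / ((t - Complex.I * (2 * ζ)) * (t + Complex.I * (2 * ζ)))) ∧
      ∀ t : ℂ, t ^ 2 = -(2 * ζ) ^ 2 → K t = -4 * (bigE q (z * t) * bigE q (-t / 2)) /
        ((1 - q) ^ 2 * deriv (besselSeries (q ^ 2) ((q ^ 2) ^ (α + 1))) y) := by
  have hp0 : 0 < q ^ 2 := by positivity
  have hp1 : q ^ 2 < 1 := pow_lt_one₀ hq0.le hq1 two_ne_zero
  have hd := differentiable_besselSeries hp0 hp1 (Real.rpow_pos_of_pos hp0 (α + 1))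
    (Real.rpow_lt_one hp0.le hp1 (by linarith))
  generalize hφ : besselSeries (q ^ 2) ((q ^ 2) ^ (α + 1)) = φ at *
  have hq : 0 < 1 - q := by linarith
  have hqc : (1 - q : ℂ) ≠ 0 := by exact_mod_cast hq.ne'
  have hψ : Differentiable ℂ (dslope φ y) := by
    rw [← differentiableOn_univ, Complex.differentiableOn_dslope univ_mem]
    exact hd.differentiableOn
  have hφψ : ∀ x, (x - y) * dslope φ y x = φ x := fun x => by
    simpa [hy] using sub_smul_dslope φ (y : ℂ) x
  have hψ0 : ∀ x : ℂ, ‖x‖ < y' → dslope φ y x ≠ 0 := by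
    intro x hx h
    have hxy := huniq x hx (by rw [← hφψ, h, mul_zero])
    rw [hxy, dslope_same] at h
    exact hdy h
  have hy0 : 0 < y := by rw [hyζ]; positivity
  have hE := differentiable_bigE hq0 hq1
  have hyc : (y : ℂ) = (ζ * (1 - q)) ^ 2 := by rw [hyζ]; push_cast; rfl
  -- The radius is chosen so that `‖t‖ < R` means `‖x‖ < y'`, where `ψ` has no zero.
  refine ⟨fun t => -4 * (bigE q (z * t) * bigE q (-t / 2)) /
    ((1 - q) ^ 2 * dslope φ y (-((1 - q) / 2 * t) ^ 2)), 2 * √y' / (1 - q), ?_, ?_, ?_, ?_⟩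
  · rw [lt_div_iff₀ hq, mul_assoc]
    refine mul_lt_mul_of_pos_left (Real.lt_sqrt_of_sq_lt ?_) two_pos
    rwa [← hyζ]
  · intro t ht
    rw [mem_ball_zero_iff, lt_div_iff₀ hq] at ht
    have hlt : ‖-((1 - q) / 2 * t : ℂ) ^ 2‖ < y' := by
      rw [norm_neg, norm_pow, norm_mul, ← Real.lt_sqrt (by positivity)]
      have : ‖((1 - q) / 2 : ℂ)‖ = (1 - q) / 2 := by
        rw [show ((1 - q) / 2 : ℂ) = (((1 - q) / 2 : ℝ) : ℂ) by push_cast; rfl, Complex.norm_real,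
          Real.norm_of_nonneg (by positivity)]
      rw [this]
      linarith
    have hden : ((1 - q) ^ 2 * dslope φ y (-((1 - q) / 2 * t) ^ 2) : ℂ) ≠ 0 :=
      mul_ne_zero (pow_ne_zero 2 hqc) (hψ0 _ hlt)
    exact DifferentiableAt.differentiableWithinAt (by fun_prop (disch := exact hden))
  · intro t
    have hg : gFun α q (Complex.I * t) = -((1 - q) ^ 2 / 4) *
        ((t - Complex.I * (2 * ζ)) * (t + Complex.I * (2 * ζ))) *
          dslope φ y (-((1 - q) / 2 * t) ^ 2) := by
      rw [gFun, modBessel2_eq_besselSeries hp0, hφ, show (Complex.I * t * (1 - q) / 2) ^ 2 =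
        -((1 - q) / 2 * t) ^ 2 by linear_combination (t * (1 - q) / 2) ^ 2 * Complex.I_sq,
        ← hφψ]
      linear_combination -dslope φ y (-((1 - q) / 2 * t) ^ 2) * hyc + ((1 - q : ℂ) ^ 2 * ζ ^ 2 * -dslope φ y (-((1 - q) / 2 * t) ^ 2)) *
        Complex.I_sq
    rw [genFun, hg]
    -- Since `0⁻¹ = 0`, inversion is multiplicative without side conditions, and the identity holds
    -- at the poles as well.
    simp only [div_eq_mul_inv, mul_inv, inv_neg, inv_inv]
    ring
  · intro t ht
    have : -((1 - q) / 2 * t : ℂ) ^ 2 = y := by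
      rw [hyc]
      linear_combination -((1 - q : ℂ) / 2) ^ 2 * ht
    simp only [this, dslope_same]

theorem isLittleO_qFact_mul {q r : ℝ} {s : ℂ} {ε : ℕ → ℂ} (hr : 0 < r) (hrs : r ≤ ‖s‖)
    (hε : Tendsto (fun n => ε n * s ^ n) atTop (𝓝 0)) (i : ℕ) :
    (fun n : ℕ => (qFact q (2 * n + i) : ℂ) * ε (2 * n + i)) =o[atTop]
      fun n : ℕ => qFact q (2 * n + i) * (r ^ (2 * n))⁻¹ := by
  refine Asymptotics.IsBigO.mul_isLittleO
    (Asymptotics.isBigO_of_le _ fun n => by simp) ?_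
  refine Asymptotics.IsLittleO.of_norm_left ((Asymptotics.isLittleO_iff_tendsto' ?_).2 ?_)
  · exact Eventually.of_forall fun n h => absurd h (by positivity)
  · have hs : 0 < ‖s‖ := hr.trans_le hrs
    have hsub : Tendsto (fun n : ℕ => 2 * n + i) atTop atTop :=
      tendsto_atTop_mono (fun n => show n ≤ 2 * n + i by omega) tendsto_id
    -- The constant `(‖s‖ ^ i)⁻¹` absorbs the gap between the exponents `2 * n + i` and `2 * n`.
    -- Equality `r = ‖s‖` is harmless because `ε n * s ^ n` already tends to `0`.
    have h := ((hε.comp hsub).norm).mul_const (‖s‖ ^ i)⁻¹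
    rw [norm_zero, zero_mul] at h
    refine squeeze_zero (fun n => by positivity) (fun n => ?_) h
    rw [div_inv_eq_mul, Function.comp_apply, norm_mul, norm_pow, pow_add, mul_assoc, mul_assoc,
      mul_inv_cancel₀ (pow_pos hs i).ne', mul_one]
    gcongr

end QBernoulli

open QBernoulli Filter Asymptotics in
theorem theorem3p1 (q α : ℝ) (hq0 : 0 < q) (hq1 : q < 1) (hα : -1 < α) :
    IsLeast {x : ℝ | 0 < x ∧ jacksonBessel2 α (q ^ 2) (x : ℂ) = 0} (firstZero α q) ∧
    modBesselDeriv α q ≠ 0 ∧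
    ∀ (z : ℂ) (r : ℝ), 0 < r → r ≤ 2 * zeta1 α q →
      ((fun n : ℕ => qBernoulli2 α q (2 * n) z -
          2 / (1 - (q : ℂ)) *
            ((-1) ^ (n + 1) * (qFact q (2 * n) : ℂ) *
              (bigCos q (2 * (zeta1 α q : ℂ) * z) * bigCos q (zeta1 α q : ℂ) +
                bigSin q (2 * (zeta1 α q : ℂ) * z) * bigSin q (zeta1 α q : ℂ)) /
              ((2 * (zeta1 α q : ℂ)) ^ (2 * n + 1) * modBesselDeriv α q)))
        =o[atTop] (fun n : ℕ => qFact q (2 * n) * (r ^ (2 * n))⁻¹)) ∧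
      ((fun n : ℕ => qBernoulli2 α q (2 * n + 1) z -
          2 / (1 - (q : ℂ)) *
            ((-1) ^ (n + 1) * (qFact q (2 * n + 1) : ℂ) *
              (bigSin q (2 * (zeta1 α q : ℂ) * z) * bigCos q (zeta1 α q : ℂ) -
                bigCos q (2 * (zeta1 α q : ℂ) * z) * bigSin q (zeta1 α q : ℂ)) /
              ((2 * (zeta1 α q : ℂ)) ^ (2 * n + 2) * modBesselDeriv α q)))
        =o[atTop] (fun n : ℕ => qFact q (2 * n + 1) * (r ^ (2 * n))⁻¹)) := by
  have hp0 : 0 < q ^ 2 := by positivity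
  have hp1 : q ^ 2 < 1 := pow_lt_one₀ hq0.le hq1 two_ne_zero
  have hq : 0 < 1 - q := by linarith
  have hqc : (1 - q : ℂ) ≠ 0 := by exact_mod_cast hq.ne'
  obtain ⟨y, hy, hdy, y', hyy', huniq⟩ := exists_isLeast_besselSeries_zero hp0 hp1
    (Real.rpow_pos_of_pos hp0 (α + 1)) (Real.rpow_lt_one hp0.le hp1 (by linarith))
  have hleast := isLeast_jacksonBessel2_zero hα hp0 hp1 hy
  have hfirst : firstZero α q = 2 * √y := hleast.csInf_eq
  have hζdef : √y = zeta1 α q * (1 - q) := by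
    rw [zeta1, hfirst]
    field_simp
  have hζ : 0 < zeta1 α q := pos_of_mul_pos_left (hζdef ▸ Real.sqrt_pos.2 hy.1.1) hq.le
  have hyζ : y = (zeta1 α q * (1 - q)) ^ 2 := by rw [← hζdef, Real.sq_sqrt hy.1.1.le]
  have hD : modBesselDeriv α q =
      deriv (besselSeries (q ^ 2) ((q ^ 2) ^ (α + 1))) y * (zeta1 α q * (1 - q)) := by
    have hc : ((2 * √y : ℝ) : ℂ) / 2 = zeta1 α q * (1 - q) := by
      rw [hζdef]
      push_cast
      ring
    rw [modBesselDeriv, deriv_modBessel2 hα hp0 hp1, hfirst, hc]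
    congr 2
    rw [hyζ]
    push_cast
    rfl
  have hζc : (zeta1 α q : ℂ) ≠ 0 := Complex.ofReal_ne_zero.2 hζ.ne'
  refine ⟨hfirst ▸ hleast, by rw [hD]; exact mul_ne_zero hdy (mul_ne_zero hζc hqc),
    fun z r hr hrζ => ?_⟩
  obtain ⟨K, R, hR, hK, hgen, hKval⟩ :=
    exists_genFun_eq hα hq0 hq1 hζ hyζ hy.1.2 hdy hyy' huniq z
  rw [hD]
  generalize zeta1 α q = ζ at *
  generalize deriv (besselSeries (q ^ 2) ((q ^ 2) ^ (α + 1))) (y : ℂ) = d at *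
  have hs : Complex.I * (2 * ζ) ≠ 0 := mul_ne_zero Complex.I_ne_zero (mul_ne_zero two_ne_zero hζc)
  have hsn : ‖Complex.I * (2 * ζ : ℂ)‖ = 2 * ζ := by simp [abs_of_pos hζ]
  obtain ⟨ε, hε, hcoeff⟩ := exists_taylorCoeff_eq_of_two_poles hs (hsn.trans_lt hR) hK hgen
  have hs2 : (Complex.I * (2 * ζ : ℂ)) ^ 2 = -(2 * ζ) ^ 2 := by rw [mul_pow, Complex.I_sq]; ring
  have hK1 := hKval (Complex.I * (2 * ζ)) hs2
  have hK2 := hKval (-(Complex.I * (2 * ζ))) (by rw [neg_sq, hs2])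
  -- At each pole the two exponentials have arguments `±i(2ζz)` and `∓iζ`, hence split into `Cos_q`
  -- and `Sin_q`.
  rw [show z * (Complex.I * (2 * ζ)) = Complex.I * (2 * ζ * z) by ring,
    show -(Complex.I * (2 * ζ : ℂ)) / 2 = -(Complex.I * ζ) by ring,
    bigE_I_mul, bigE_neg_I_mul] at hK1
  rw [show z * -(Complex.I * (2 * ζ)) = -(Complex.I * (2 * ζ * z)) by ring,
    show - -(Complex.I * (2 * ζ : ℂ)) / 2 = Complex.I * ζ by ring,
    bigE_I_mul, bigE_neg_I_mul] at hK2
  generalize bigCos q (2 * ζ * z) = C at *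
  generalize bigSin q (2 * ζ * z) = S at *
  generalize bigCos q ζ = c at *
  generalize bigSin q ζ = s at *
  have hpow : ∀ n : ℕ, (Complex.I * (2 * ζ : ℂ)) ^ (2 * n + 2) = (-1) ^ (n + 1) * (2 * ζ) ^ (2 * n + 2) := by
    intro n
    rw [show 2 * n + 2 = 2 * (n + 1) by ring, pow_mul, hs2, neg_pow, ← pow_mul]
  constructor
  · refine (isLittleO_qFact_mul hr (hrζ.trans hsn.ge) hε 0).congr_left fun n => ?_
    have e1 : K (Complex.I * (2 * ζ)) + K (-(Complex.I * (2 * ζ))) =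
        -8 * (C * c + S * s) / ((1 - q) ^ 2 * d) := by
      rw [hK1, hK2, ← add_div]
      congr 1
      linear_combination 8 * S * s * Complex.I_sq
    have e2 := hcoeff (2 * n)
    -- At an even index the residues add. One factor `2ζ` of the power is split off to match the `ζ`
    -- contained in the derivative at the zero.
    rw [pow_mul (-1 : ℂ) 2 n, neg_one_sq, one_pow, one_mul, e1, hpow, pow_succ _ (2 * n + 1)] at e2
    rw [qBernoulli2, e2, add_zero]
    have hY : (2 * ζ : ℂ) ^ (2 * n + 1) ≠ 0 := pow_ne_zero _ (mul_ne_zero two_ne_zero hζc)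
    generalize (2 * ζ : ℂ) ^ (2 * n + 1) = Y at *
    rcases neg_one_pow_eq_or ℂ (n + 1) with h | h <;> rw [h] <;> field_simp <;> ring
  · refine (isLittleO_qFact_mul hr (hrζ.trans hsn.ge) hε 1).congr_left fun n => ?_
    have e1 : K (Complex.I * (2 * ζ)) - K (-(Complex.I * (2 * ζ))) =
        -8 * Complex.I * (S * c - C * s) / ((1 - q) ^ 2 * d) := by
      rw [hK1, hK2, ← sub_div]
      congr 1
      ring
    have e2 := hcoeff (2 * n + 1)
    -- At an odd index the residues subtract, and the extra factor `2iζ` of the power cancels the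
    -- `i` in their difference.
    rw [pow_succ (-1 : ℂ), pow_mul (-1 : ℂ) 2 n, neg_one_sq, one_pow, one_mul, neg_one_mul,
      ← sub_eq_add_neg, e1, show 2 * n + 1 + 2 = 2 * n + 2 + 1 by ring, pow_succ _ (2 * n + 2),
      hpow] at e2
    rw [qBernoulli2, e2]
    have hY : (2 * ζ : ℂ) ^ (2 * n + 2) ≠ 0 := pow_ne_zero _ (mul_ne_zero two_ne_zero hζc)
    have hI := Complex.I_ne_zero
    generalize (2 * ζ : ℂ) ^ (2 * n + 2) = Y at *
    rcases neg_one_pow_eq_or ℂ (n + 1) with h | h <;> rw [h] <;> field_simp <;> ring
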